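/- **Notation.** For a uniform space $X$, let $U_b(X)$ be the Banach space of bounded uniformly continuous real-valued functions on $X$ with the sup norm. A subset of $U_b(X)$ is called ueb if it is uniformly equicontinuous and bounded in the sup norm. The ueb topology on the Banach space dual $U_b(X)^*$ is the topology of uniform convergence on ueb sets. The space $M(X)$ of uniform measures is the closure in the ueb topology of the linear span of the point masses $\partial(x)\colon f\mapsto f(x)$, $x\in X$, in $U_b(X)^*$, and $M(X)^+=\{\mu\in M(X) : \mu(f)\ge 0 \text{ for all } f\in U_b(X),\ f\ge 0\}$. A uniformly continuous mapping $\varphi\colon X\to Y$ defines the linear mapping $M(\varphi)\colon M(X)\to M(Y)$, $M(\varphi)(\mu)(f)=\mu(f\circ\varphi)$, the unique ueb continuous linear mapping with $M(\varphi)(\partial(x))=\partial(\varphi(x))$ for all $x\in X$. It maps $M(X)^+$ into $M(Y)^+$. **Theorem** (general embedding theorem). Let $P_0$ and $P_1$ be two point-separating sets of pseudometrics on a set $S$. For $j=0,1$ let $X_j$ be the uniform space induced by $P_j$, that is, $S$ with the coarsest uniform structure for which every pseudometric in $P_j$ is uniformly continuous. Let $X_\vee$ be $S$ with the coarsest uniform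 structure that is finer than those of $X_0$ and $X_1$, and let $X_\wedge$ be $S$ with the finest uniform structure that is coarser than those of $X_0$ and $X_1$. For $\alpha\beta\in\{\vee 0,\vee 1,0\wedge,1\wedge,\vee\wedge\}$ let $\iota_{\alpha\beta}\colon X_\alpha\to X_\beta$ be the (uniformly continuous) identity mapping. Assume that * for all $\rho\in P_0$ and $z\in S$ the function $x\mapsto\rho(x,z)$ is uniformly continuous on $X_1$; * for all $\rho\in P_1$ and $z\in S$ the function $x\mapsto\rho(x,z)$ is uniformly continuous on $X_0$. Then for every $\alpha\beta\in\{\vee 0,\vee 1,0\wedge,1\wedge,\vee\wedge\}$ the mapping $M(\iota_{\alpha\beta})\colon M(X_\alpha)\to M(X_\beta)$ is injective, and its restriction to $M(X_\alpha)^+$ with the ueb topology is a topological embedding into $M(X_\beta)^+$ with the ueb topology. Moreover, $$M(\iota_{\vee\wedge})(M(X_\vee)) = M(\iota_{0\wedge})(M(X_0))\cap M(\iota_{1\wedge})(M(X_1)).$$ -/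

import Mathlib

open scoped BoundedContinuousFunction

noncomputable section

namespace UniformMeasure

/-! ### Uniform structures on a fixed set -/

/-- The set `S` regarded as a (pre)uniform space through the uniform structure `u`. -/
@[nolint unusedArguments]
def Space {S : Type*} (_u : UniformSpace S) : Type _ := S

instance {S : Type*} (u : UniformSpace S) : UniformSpace (Space u) := u

/-- The uniform structure of a single pseudometric, with the sets `{(x, y) | ρ x y < ε}`,
`ε > 0`, as a base of entourages. -/
@[reducible]
def pseudometricUniformity {S : Type*} (ρ : PseudoMetric S ℝ) : UniformSpace S :=
  UniformSpace.ofDist ρ ρ.refl ρ.symm ρ.triangle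

/-- The uniform structure induced by a set of pseudometrics: the coarsest one for which all of
them are uniformly continuous. (In Mathlib's order on uniform structures, `u ≤ v` means that `u`
is finer than `v`, so that the coarsest common refinement is an infimum.) -/
@[reducible]
def inducedUniformity {S : Type*} (P : Set (PseudoMetric S ℝ)) : UniformSpace S :=
  ⨅ ρ ∈ P, pseudometricUniformity ρ

/-- A set of pseudometrics separates the points of `S`. -/
def SeparatesPoints {S : Type*} (P : Set (PseudoMetric S ℝ)) : Prop :=
  ∀ x y : S, x ≠ y → ∃ ρ ∈ P, ρ x y ≠ 0

/-! ### Bounded uniformly continuous functions and their dual -/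

section Definitions

variable (X : Type*) [UniformSpace X]

/-- The space of bounded uniformly continuous real-valued functions on `X`, with the sup norm. -/
def Ub : Submodule ℝ (X →ᵇ ℝ) where
  carrier := {f | UniformContinuous f}
  zero_mem' := uniformContinuous_const
  add_mem' hf hg := UniformContinuous.add hf hg
  smul_mem' c _ hf := UniformContinuous.const_smul hf c

variable {X} in
/-- A set of functions in `Ub X` is *ueb* if it is uniformly equicontinuous and uniformly bounded
in the sup norm. -/
def IsUEB (H : Set (Ub X)) : Prop :=
  UniformEquicontinuous (fun (f : H) (x : X) => (f : Ub X).1 x) ∧ ∃ C : ℝ, ∀ f ∈ H, ‖f‖ ≤ C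

/-- The Banach space dual of `Ub X`, with the *ueb* topology: the topology of uniform convergence
on ueb sets. -/
abbrev Dual : Type _ := UniformConvergenceCLM (RingHom.id ℝ) (E := Ub X) ℝ {H | IsUEB H}

instance : ContinuousSMul ℝ (Dual X) :=
  UniformConvergenceCLM.continuousSMul _ _ _ fun _ hH =>
    (NormedSpace.isVonNBounded_iff ℝ (E := Ub X)).2
      ((isBounded_iff_forall_norm_le (E := Ub X)).2 hH.2)

variable {X} in
/-- The point mass at `x`: the functional `f ↦ f x`. -/
def pointMass (x : X) : Dual X :=
  UniformConvergenceCLM.ofFun _ _ _ ((BoundedContinuousFunction.evalCLM ℝ x).comp (Ub X).subtypeL)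

/-- The molecular measures: finite linear combinations of point masses. -/
def Mol : Submodule ℝ (Dual X) := Submodule.span ℝ (Set.range pointMass)

/-- The uniform measures on `X`: the ueb closure of the molecular measures in the dual. -/
def UMeas : Submodule ℝ (Dual X) := (Mol X).topologicalClosure

/-- The positive cone of the space of uniform measures. -/
def UMeasPos : Set (UMeas X) := {μ | ∀ f : Ub X, (∀ x, 0 ≤ f.1 x) → 0 ≤ μ.1 f}

end Definitions

/-! ### Functoriality -/

section Map

variable {X Y : Type*} [UniformSpace X] [UniformSpace Y]

/-- Composition with a uniformly continuous mapping, as a map `Ub Y → Ub X`. -/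
def Ub.comp (φ : X → Y) (hφ : UniformContinuous φ) : Ub Y →L[ℝ] Ub X :=
  LinearMap.mkContinuous (E := Ub Y) (F := Ub X) (σ := RingHom.id ℝ)
    { toFun := fun f => ⟨f.1.compContinuous ⟨φ, hφ.continuous⟩, UniformContinuous.comp f.2 hφ⟩
      map_add' := fun _ _ => rfl
      map_smul' := fun _ _ => rfl } 1 fun f => by
    rw [one_mul]
    exact (BoundedContinuousFunction.norm_le (norm_nonneg f)).2 fun x => f.1.norm_coe_le_norm (φ x)

theorem IsUEB.comp {H : Set (Ub Y)} (hH : IsUEB H) (φ : X → Y) (hφ : UniformContinuous φ) :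
    IsUEB (Ub.comp φ hφ '' H) := by
  refine ⟨fun V hV => ?_, hH.2.imp fun C hC => ?_⟩
  · filter_upwards [hφ (hH.1 V hV)] with p hp
    rintro ⟨_, f, hf, rfl⟩
    exact hp ⟨f, hf⟩
  · rintro _ ⟨f, hf, rfl⟩
    exact ((BoundedContinuousFunction.norm_le (norm_nonneg f)).2
      fun x => f.1.norm_coe_le_norm (φ x)).trans (hC f hf)

/-- The continuous linear map of duals `μ ↦ (f ↦ μ (f ∘ φ))`. -/
def Dual.map (φ : X → Y) (hφ : UniformContinuous φ) : Dual X →L[ℝ] Dual Y :=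
  ContinuousLinearMap.precompUniformConvergenceCLM ℝ _ _ (Ub.comp φ hφ)
    fun _ hH => IsUEB.comp hH φ hφ

theorem Dual.map_apply (φ : X → Y) (hφ : UniformContinuous φ) (μ : Dual X) (f : Ub Y) :
    Dual.map φ hφ μ f = μ (Ub.comp φ hφ f) := rfl

theorem Dual.map_pointMass (φ : X → Y) (hφ : UniformContinuous φ) (x : X) :
    Dual.map φ hφ (pointMass x) = pointMass (φ x) := rfl

theorem Dual.map_mem_UMeas (φ : X → Y) (hφ : UniformContinuous φ) {μ : Dual X}
    (hμ : μ ∈ UMeas X) : Dual.map φ hφ μ ∈ UMeas Y := by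
  refine map_mem_closure (Dual.map φ hφ).continuous hμ fun ν hν => ?_
  have h : Mol X ≤ (Mol Y).comap (Dual.map φ hφ).toLinearMap :=
    Submodule.span_le.2 (by
      rintro _ ⟨x, rfl⟩
      exact Submodule.subset_span ⟨φ x, rfl⟩)
  exact h hν

/-- The mapping `M(φ) : M(X) → M(Y)` of spaces of uniform measures defined by a uniformly continuous
mapping `φ : X → Y`: the continuous linear mapping that sends the point mass at `x` to the point
mass at `φ x` (see `Dual.map_pointMass`; point masses span a dense subspace of `M(X)`). -/
def UMeas.map (φ : X → Y) (hφ : UniformContinuous φ) : UMeas X →L[ℝ] UMeas Y :=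
  ((Dual.map φ hφ).comp (UMeas X).subtypeL).codRestrict (UMeas Y)
    fun μ => Dual.map_mem_UMeas φ hφ μ.2

theorem UMeas.map_mem_pos (φ : X → Y) (hφ : UniformContinuous φ) :
    Set.MapsTo (UMeas.map φ hφ) (UMeasPos X) (UMeasPos Y) :=
  fun _ hμ f hf => hμ (Ub.comp φ hφ f) fun x => hf (φ x)

/-- The restriction of `UMeas.map` to the positive cones, which carry the ueb topology. -/
def UMeas.mapPos (φ : X → Y) (hφ : UniformContinuous φ) : UMeasPos X → UMeasPos Y :=
  (UMeas.map_mem_pos φ hφ).restrict _ _ _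

end Map

/-- The mapping `M(ι) : M(X) → M(Y)` for the identity mapping `ι` of `S`, where `X` and `Y` are uniform spaces
on `S` and `X` is finer than `Y`. -/
def idMap {S : Type*} {u v : UniformSpace S} (h : u ≤ v) :
    UMeas (Space u) →L[ℝ] UMeas (Space v) :=
  UMeas.map (X := Space u) (Y := Space v) (fun x => x) h

/-- The restriction of `idMap` to the positive cones. -/
def idMapPos {S : Type*} {u v : UniformSpace S} (h : u ≤ v) :
    UMeasPos (Space u) → UMeasPos (Space v) :=
  UMeas.mapPos (X := Space u) (Y := Space v) (fun x => x) h

/-- The mapping of spaces of uniform measures defined by the identity mapping of `S` is injective,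
and its restriction to the positive cones is a topological embedding for the ueb topologies. -/
def IsInjectivePosEmbedding {S : Type*} {u v : UniformSpace S} (h : u ≤ v) : Prop :=
  Function.Injective (idMap h) ∧ Topology.IsEmbedding (idMapPos h)

end UniformMeasure

end

noncomputable section

namespace UniformMeasure

/-! Everything is tested on the truncated distances `truncDist d L` to finite sets. A function with
small oscillation on the unit `d`-balls is, up to a small error and an error dominated by a multiple
of `truncDist d L`, a finite combination of such functions (`abs_sub_approx_sub_mul_le`). A uniform
measure is nearly blind to the second error for suitable `L` (`UMeas.tight`); conversely, this
tightness along a base of pseudometrics characterizes uniform measures (`mem_UMeas_of_tight`).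

The hypotheses say that the sections of the pseudometrics, hence the truncated distances, are
uniformly continuous already on the coarser space. So the image of a uniform measure determines its
values on them, and thereby the measure itself; this gives injectivity. On positive cones, pointwise
convergence on these functions forces ueb convergence, because the value at `truncDist d L` itself
controls the error (`tendsto_of_tendsto_truncUb`).

For the intersection, a common image of two uniform measures is extended by Hahn–Banach, with the
same norm, to the bounded uniformly continuous functions of the common refinement. Equality of norms
lets tightness be checked on the coarse space (`tight_of_extension`); tightness survives weighted
sums of pseudometrics (`Tight.of_le_mul_add`), so the extension is a uniform measure. -/

open Filter Topology Uniformity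

/-! ### Bounded uniformly continuous functions, ueb neighbourhoods, molecular measures -/

section Basics

variable {X : Type*} [UniformSpace X]

/-- A bounded uniformly continuous function, as an element of `Ub X`. -/
def Ub.of (f : X → ℝ) (hf : UniformContinuous f) (C : ℝ) (hC : ∀ x, |f x| ≤ C) : Ub X :=
  ⟨BoundedContinuousFunction.ofNormedAddCommGroup f hf.continuous C hC, hf⟩

@[simp] theorem Ub.of_apply (f : X → ℝ) (hf : UniformContinuous f) (C : ℝ)
    (hC : ∀ x, |f x| ≤ C) (x : X) : (Ub.of f hf C hC).1 x = f x := rfl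

theorem Ub.ext {f g : Ub X} (h : ∀ x, f.1 x = g.1 x) : f = g :=
  Subtype.ext (BoundedContinuousFunction.ext h)

theorem Ub.norm_le {f : Ub X} {C : ℝ} (hC : 0 ≤ C) : ‖f‖ ≤ C ↔ ∀ x, |f.1 x| ≤ C :=
  BoundedContinuousFunction.norm_le hC

theorem Ub.abs_le_norm (f : Ub X) (x : X) : |f.1 x| ≤ ‖f‖ := f.1.norm_coe_le_norm x

theorem Ub.sub_apply (f g : Ub X) (x : X) : (f - g).1 x = f.1 x - g.1 x := rfl

theorem Ub.add_apply (f g : Ub X) (x : X) : (f + g).1 x = f.1 x + g.1 x := rfl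

theorem Ub.smul_apply (c : ℝ) (f : Ub X) (x : X) : (c • f).1 x = c * f.1 x := rfl

theorem Ub.comp_apply {Y : Type*} [UniformSpace Y] (φ : X → Y) (hφ : UniformContinuous φ)
    (f : Ub Y) (x : X) : (Ub.comp φ hφ f).1 x = f.1 (φ x) := rfl

theorem uniformContinuous_real_iff {f : X → ℝ} :
    UniformContinuous f ↔ ∀ ε > 0, ∀ᶠ p : X × X in 𝓤 X, |f p.1 - f p.2| < ε :=
  Metric.uniformity_basis_dist.tendsto_right_iff

theorem abs_mul_sub_mul_le {a b c d A B : ℝ} (ha : |a| ≤ A) (hd : |d| ≤ B) :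
    |a * b - c * d| ≤ A * |b - d| + B * |a - c| := by
  have h : a * b - c * d = a * (b - d) + d * (a - c) := by ring
  rw [h]
  refine (abs_add_le _ _).trans ?_
  rw [abs_mul, abs_mul]
  gcongr

/-- The product of bounded uniformly continuous functions. -/
def Ub.mul (f g : Ub X) : Ub X :=
  Ub.of (fun x => f.1 x * g.1 x)
    (by
      rw [uniformContinuous_real_iff]
      intro ε hε
      have hpos : 0 < ‖f‖ + ‖g‖ + 1 := by positivity
      have hδ : 0 < ε / (‖f‖ + ‖g‖ + 1) := by positivity
      filter_upwards [uniformContinuous_real_iff.1 f.2 _ hδ,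
        uniformContinuous_real_iff.1 g.2 _ hδ] with p hf hg
      have h := abs_mul_sub_mul_le (b := g.1 p.1) (c := f.1 p.2) (Ub.abs_le_norm f p.1)
        (Ub.abs_le_norm g p.2)
      rw [lt_div_iff₀ hpos] at hf hg
      nlinarith [norm_nonneg f, norm_nonneg g, abs_nonneg (f.1 p.1 - f.1 p.2),
        abs_nonneg (g.1 p.1 - g.1 p.2)]) (‖f‖ * ‖g‖) fun x => by
    rw [abs_mul]
    exact mul_le_mul (Ub.abs_le_norm f x) (Ub.abs_le_norm g x) (abs_nonneg _)
      ((abs_nonneg _).trans (Ub.abs_le_norm f x))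

@[simp] theorem Ub.mul_apply (f g : Ub X) (x : X) : (Ub.mul f g).1 x = f.1 x * g.1 x := rfl

theorem isUEB_iff {H : Set (Ub X)} : IsUEB H ↔
    (∀ ε > 0, ∀ᶠ p : X × X in 𝓤 X, ∀ f ∈ H, |f.1 p.1 - f.1 p.2| < ε) ∧
      ∃ C : ℝ, ∀ f ∈ H, ‖f‖ ≤ C := by
  refine and_congr_left fun _ => ?_
  rw [Metric.uniformity_basis_dist.uniformEquicontinuous_iff_right]
  simp [Real.dist_eq]

theorem IsUEB.union {H K : Set (Ub X)} (hH : IsUEB H) (hK : IsUEB K) : IsUEB (H ∪ K) := by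
  rw [isUEB_iff] at *
  obtain ⟨hH, C, hC⟩ := hH
  obtain ⟨hK, D, hD⟩ := hK
  refine ⟨fun ε hε => ?_, max C D, ?_⟩
  · filter_upwards [hH ε hε, hK ε hε] with p h1 h2 f hf using hf.elim (h1 f) (h2 f)
  · exact fun f hf => hf.elim (fun h => (hC f h).trans (le_max_left _ _))
      fun h => (hD f h).trans (le_max_right _ _)

theorem isUEB_singleton (f : Ub X) : IsUEB {f} := by
  rw [isUEB_iff]
  refine ⟨fun ε hε => ?_, ‖f‖, by simp⟩
  simpa using uniformContinuous_real_iff.1 f.2 ε hε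

theorem Dual.hasBasis_nhds (μ : Dual X) :
    (𝓝 μ).HasBasis (fun p : Set (Ub X) × ℝ => IsUEB p.1 ∧ 0 < p.2)
      fun p => {ν | ∀ f ∈ p.1, |ν f - μ f| < p.2} := by
  have h := UniformConvergenceCLM.hasBasis_nhds_zero_of_basis (RingHom.id ℝ) (E := Ub X) ℝ
    {H | IsUEB H} ⟨{0}, isUEB_singleton 0⟩
    (fun H hH K hK => ⟨H ∪ K, hH.union hK, Set.subset_union_left, Set.subset_union_right⟩)
    Metric.nhds_basis_ball
  have h2 := h.comap (fun ν : Dual X => ν - μ)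
  rw [nhds_translation_sub] at h2
  refine h2.congr (fun _ => Iff.rfl) fun p _ => ?_
  ext ν
  simp

theorem Dual.mem_UMeas_iff {μ : Dual X} : μ ∈ UMeas X ↔
    ∀ H : Set (Ub X), IsUEB H → ∀ ε > 0, ∃ ν ∈ Mol X, ∀ f ∈ H, |ν f - μ f| < ε := by
  change μ ∈ closure (Mol X : Set (Dual X)) ↔ _
  rw [mem_closure_iff_nhds_basis (Dual.hasBasis_nhds μ)]
  exact ⟨fun h H hH ε hε => h (H, ε) ⟨hH, hε⟩, fun h p hp => h p.1 hp.1 p.2 hp.2⟩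

theorem Dual.continuous_eval (f : Ub X) : Continuous fun μ : Dual X => μ f :=
  continuous_iff_continuousAt.2 fun μ => by
    refine ((Dual.hasBasis_nhds μ).tendsto_iff Metric.nhds_basis_ball).2 fun ε hε =>
      ⟨({f}, ε), ⟨isUEB_singleton f, hε⟩, fun ν hν => ?_⟩
    simpa [Real.dist_eq] using hν

/-- The list is a finite support. Truncated distances to it vanish on it, so they are invisible to
`ν`. -/
theorem Mol.exists_list {ν : Dual X} (hν : ν ∈ Mol X) :
    ∃ L : List X, ∀ f : Ub X, (∀ x ∈ L, f.1 x = 0) → ν f = 0 := by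
  induction hν using Submodule.span_induction with
  | mem _ h =>
    obtain ⟨x, rfl⟩ := h
    exact ⟨[x], fun f hf => hf x (by simp)⟩
  | zero => exact ⟨[], fun _ _ => rfl⟩
  | add μ ν _ _ hμ hν =>
    obtain ⟨L, hL⟩ := hμ
    obtain ⟨M, hM⟩ := hν
    refine ⟨L ++ M, fun f hf => ?_⟩
    change μ f + ν f = 0
    rw [hL f fun x hx => hf x (by simp [hx]), hM f fun x hx => hf x (by simp [hx]), add_zero]
  | smul c ν _ hν =>
    obtain ⟨L, hL⟩ := hν
    refine ⟨L, fun f hf => ?_⟩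
    change c * ν f = 0
    rw [hL f hf, mul_zero]

/-- An element of the dual as a continuous linear form on the Banach space `Ub X`. -/
def Dual.toCLM (μ : Dual X) : Ub X →L[ℝ] ℝ := μ

theorem Dual.toCLM_apply (μ : Dual X) (f : Ub X) : μ.toCLM f = μ f := rfl

/-- The truncated distance `min 1 (d x L)` to a finite set, given as a list. -/
def truncDist {X : Type*} (d : PseudoMetric X ℝ) : List X → X → ℝ
  | [], _ => 1
  | z :: L, x => min (d x z) (truncDist d L x)

/-! ### Truncated distances to finite sets -/

section TruncDist

variable {X : Type*} (d : PseudoMetric X ℝ)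

theorem truncDist_nonneg (L : List X) (x : X) : 0 ≤ truncDist d L x := by
  induction L with
  | nil => exact zero_le_one
  | cons z L ih => exact le_min (d.nonneg x z) ih

theorem truncDist_le_one (L : List X) (x : X) : truncDist d L x ≤ 1 := by
  induction L with
  | nil => exact le_rfl
  | cons z L ih => exact (min_le_right _ _).trans ih

theorem truncDist_le {L : List X} {z : X} (hz : z ∈ L) (x : X) : truncDist d L x ≤ d x z := by
  induction L with
  | nil => simp at hz
  | cons y L ih =>
    rcases List.mem_cons.1 hz with rfl | h
    · exact min_le_left _ _
    · exact (min_le_right _ _).trans (ih h)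

theorem truncDist_eq_zero {L : List X} {z : X} (hz : z ∈ L) : truncDist d L z = 0 :=
  le_antisymm ((truncDist_le d hz z).trans_eq (d.refl z)) (truncDist_nonneg d L z)

theorem exists_of_truncDist_lt {L : List X} {x : X} {r : ℝ} (hr : r ≤ 1)
    (h : truncDist d L x < r) : ∃ z ∈ L, d x z < r := by
  induction L with
  | nil => exact absurd h (not_lt.2 hr)
  | cons z L ih =>
    rcases min_lt_iff.1 h with h | h
    · exact ⟨z, by simp, h⟩
    · obtain ⟨y, hy, h⟩ := ih h
      exact ⟨y, by simp [hy], h⟩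

theorem truncDist_sub_le (L : List X) (x y : X) :
    |truncDist d L x - truncDist d L y| ≤ d x y := by
  induction L with
  | nil => simpa [truncDist] using d.nonneg x y
  | cons z L ih =>
    refine (abs_min_sub_min_le_max _ _ _ _).trans (max_le ?_ ih)
    rw [abs_sub_le_iff]
    have h1 := d.triangle x y z
    have h2 := d.triangle y x z
    rw [d.symm y x] at h2
    constructor <;> linarith

/-- Only the sections of `d` enter; `d` itself need not be uniformly continuous on `Y`. -/
theorem uniformContinuous_truncDist {Y : Type*} [UniformSpace Y] {ψ : Y → X}
    (h : ∀ z, UniformContinuous fun y => d (ψ y) z) (L : List X) :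
    UniformContinuous fun y => truncDist d L (ψ y) := by
  induction L with
  | nil => exact uniformContinuous_const
  | cons z L ih => exact lipschitzWith_min.uniformContinuous.comp ((h z).prodMk ih)

end TruncDist

end Basics

/-! ### Operator norms and nearly norming functions -/

section Norm

theorem exists_opNorm {E : Type*} [NormedAddCommGroup E] [NormedSpace ℝ E] (n : E →L[ℝ] ℝ) :
    0 ≤ ‖n‖ ∧ (∀ f, |n f| ≤ ‖n‖ * ‖f‖) ∧ ∀ η > 0, ∃ g : E, ‖g‖ ≤ 1 ∧ ‖n‖ - η ≤ n g := by
  refine ⟨norm_nonneg n, n.le_opNorm, fun η hη => ?_⟩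
  obtain ⟨g, hg, h⟩ := n.exists_lt_apply_of_lt_opNorm (sub_lt_self ‖n‖ hη)
  rcases le_total 0 (n g) with h0 | h0
  · refine ⟨g, hg.le, ?_⟩
    rw [Real.norm_of_nonneg h0] at h
    exact h.le
  · refine ⟨-g, by rw [norm_neg]; exact hg.le, ?_⟩
    rw [Real.norm_of_nonpos h0] at h
    rw [map_neg]
    exact h.le

variable {X : Type*} [UniformSpace X]

/-- `N` is the operator norm of the linear form `n`. -/
structure IsOpNorm (n : Ub X →L[ℝ] ℝ) (N : ℝ) : Prop where
  nonneg : 0 ≤ N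
  le : ∀ f, |n f| ≤ N * ‖f‖
  exists_norming : ∀ η > 0, ∃ g : Ub X, ‖g‖ ≤ 1 ∧ N - η ≤ n g

theorem exists_isOpNorm (n : Ub X →L[ℝ] ℝ) : ∃ N, IsOpNorm n N :=
  have h := exists_opNorm (E := Ub X) n
  ⟨_, h.1, h.2.1, h.2.2⟩

theorem Ub.map_sub (n : Ub X →L[ℝ] ℝ) (f g : Ub X) : n (f - g) = n f - n g := by
  have h : f - g + g = f := Ub.ext fun x => sub_add_cancel (f.1 x) (g.1 x)
  rw [eq_sub_iff_add_eq, ← map_add, h]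

theorem IsOpNorm.abs_le {n : Ub X →L[ℝ] ℝ} {N : ℝ} (hN : IsOpNorm n N) {h : Ub X} {C : ℝ}
    (hC : 0 ≤ C) (hh : ∀ x, |h.1 x| ≤ C) : |n h| ≤ N * C :=
  (hN.le h).trans (mul_le_mul_of_nonneg_left ((Ub.norm_le hC).2 hh) hN.nonneg)

end Norm

/-! ### Tightness and its equivalence with being a uniform measure -/

section Tightness

variable {X : Type*} [UniformSpace X]

/-- A pseudometric on `X` is uniformly continuous. -/
def UCont (d : PseudoMetric X ℝ) : Prop := ∀ ε > 0, ∀ᶠ p : X × X in 𝓤 X, d p.1 p.2 < ε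

theorem UCont.uniformContinuous_left {d : PseudoMetric X ℝ} (hd : UCont d) (z : X) :
    UniformContinuous fun x => d x z := by
  refine uniformContinuous_real_iff.2 fun ε hε => ?_
  filter_upwards [hd ε hε] with p hp
  refine lt_of_le_of_lt ?_ hp
  rw [abs_sub_le_iff]
  have h1 := d.triangle p.1 p.2 z
  have h2 := d.triangle p.2 p.1 z
  rw [d.symm p.2 p.1] at h2
  constructor <;> linarith

/-- The truncated distance to a finite set, as a bounded uniformly continuous function. -/
def truncUb {d : PseudoMetric X ℝ} (hd : UCont d) (L : List X) : Ub X :=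
  Ub.of (truncDist d L) (uniformContinuous_truncDist (ψ := id) d hd.uniformContinuous_left L) 1 fun x => by
    rw [abs_of_nonneg (truncDist_nonneg d L x)]
    exact truncDist_le_one d L x

@[simp] theorem truncUb_apply {d : PseudoMetric X ℝ} (hd : UCont d) (L : List X) (x : X) :
    (truncUb hd L).1 x = truncDist d L x := rfl

/-- An approximation of `f` by a finite combination of functions that depend only on `d`. -/
def approx {d : PseudoMetric X ℝ} (hd : UCont d) (f : Ub X) : List X → Ub X
  | [] => 0
  | z :: L => f.1 z • (truncUb hd L - truncUb hd (z :: L)) + approx hd f L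

theorem approx_cons_apply {d : PseudoMetric X ℝ} (hd : UCont d) (f : Ub X) (z : X) (L : List X)
    (x : X) : (approx hd f (z :: L)).1 x =
      f.1 z * (truncDist d L x - truncDist d (z :: L) x) + (approx hd f L).1 x := rfl

theorem map_approx_cons {d : PseudoMetric X ℝ} (hd : UCont d) (n : Ub X →L[ℝ] ℝ) (f : Ub X)
    (z : X) (L : List X) : n (approx hd f (z :: L)) =
      f.1 z * (n (truncUb hd L) - n (truncUb hd (z :: L))) + n (approx hd f L) := by
  rw [approx, map_add, map_smul, Ub.map_sub, smul_eq_mul]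

/-- The weight of `f z` in `approx` is the drop of the truncated distance when `z` is adjoined. The
weights are nonnegative, telescope to `1 - truncDist d L x`, and at `x` the weight of `z` is nonzero
only if `d x z < 1`, where `f x` and `f z` differ by at most `ε`. -/
theorem abs_sub_approx_sub_mul_le {d : PseudoMetric X ℝ} (hd : UCont d) {f : Ub X} {ε : ℝ}
    (hf : ∀ x y, d x y < 1 → |f.1 x - f.1 y| ≤ ε) (L : List X) (x : X) :
    |f.1 x - (approx hd f L).1 x - f.1 x * truncDist d L x| ≤ ε * (1 - truncDist d L x) := by
  induction L with
  | nil =>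
    have h0 : (approx hd f []).1 x = 0 := rfl
    simp [truncDist, h0]
  | cons z L ih =>
    rw [approx_cons_apply]
    set w := truncDist d L x - truncDist d (z :: L) x with hw
    have hw0 : 0 ≤ w := sub_nonneg.2 (min_le_right _ _)
    have h2 : |(f.1 x - f.1 z) * w| ≤ ε * w := by
      rw [abs_mul, abs_of_nonneg hw0]
      rcases hw0.eq_or_lt with h | h
      · simp [← h]
      · refine mul_le_mul_of_nonneg_right (hf x z ?_) hw0
        have h3 : truncDist d (z :: L) x < truncDist d L x := sub_pos.1 h
        rcases min_lt_iff.1 h3 with h4 | h4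
        · exact h4.trans_le (truncDist_le_one d L x)
        · exact absurd h4 (lt_irrefl _)
    have e : f.1 x - (f.1 z * w + (approx hd f L).1 x) - f.1 x * truncDist d (z :: L) x =
        (f.1 x - (approx hd f L).1 x - f.1 x * truncDist d L x) + (f.1 x - f.1 z) * w := by
      rw [hw]; ring
    rw [e]
    refine (abs_add_le _ _).trans ((add_le_add ih h2).trans_eq ?_)
    rw [hw]; ring

/-- A linear form `n` is tight with respect to `d` if it is small on functions dominated by the
truncated distance to a suitable finite set. -/
def Tight (n : Ub X →L[ℝ] ℝ) (d : PseudoMetric X ℝ) : Prop :=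
  ∀ ε > 0, ∃ L : List X, ∀ h : Ub X, (∀ x, |h.1 x| ≤ truncDist d L x) → |n h| ≤ ε

theorem abs_map_le_of_abs_le_mul (n : Ub X →L[ℝ] ℝ) {t : X → ℝ} {η : ℝ}
    (hη : ∀ h : Ub X, (∀ x, |h.1 x| ≤ t x) → |n h| ≤ η) {h : Ub X} {C : ℝ} (hC : 0 < C)
    (hh : ∀ x, |h.1 x| ≤ C * t x) : |n h| ≤ C * η := by
  have h1 := hη (C⁻¹ • h) fun x => by
    rw [Ub.smul_apply, abs_mul, abs_of_pos (inv_pos.2 hC), inv_mul_le_iff₀ hC]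
    exact hh x
  rwa [map_smul, smul_eq_mul, abs_mul, abs_of_pos (inv_pos.2 hC), inv_mul_le_iff₀ hC] at h1

/-- With `t` the truncated distance, `f - approx` is a function bounded by `ε` plus `f * t`. The
bounds `A` and `η` are left abstract so that they can come from the operator norm and tightness, or
from positivity. -/
theorem abs_map_sub_map_approx_le {d : PseudoMetric X ℝ} (hd : UCont d) (n : Ub X →L[ℝ] ℝ)
    {f : Ub X} {ε A η C : ℝ} {L : List X} (hε : 0 ≤ ε)
    (hf : ∀ x y, d x y < 1 → |f.1 x - f.1 y| ≤ ε)
    (hA : ∀ h : Ub X, (∀ x, |h.1 x| ≤ ε) → |n h| ≤ A)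
    (hη : ∀ h : Ub X, (∀ x, |h.1 x| ≤ truncDist d L x) → |n h| ≤ η)
    (hC : 0 < C) (hfC : ‖f‖ ≤ C) : |n f - n (approx hd f L)| ≤ A + C * η := by
  have e : n f - n (approx hd f L) =
      n (f - approx hd f L - Ub.mul f (truncUb hd L)) + n (Ub.mul f (truncUb hd L)) := by
    rw [Ub.map_sub, Ub.map_sub]; ring
  rw [e]
  refine (abs_add_le _ _).trans (add_le_add (hA _ fun x => ?_)
    (abs_map_le_of_abs_le_mul n hη hC fun x => ?_))
  · refine (abs_sub_approx_sub_mul_le hd hf L x).trans ?_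
    exact mul_le_of_le_one_right hε (by linarith [truncDist_nonneg d L x])
  · rw [Ub.mul_apply, truncUb_apply, abs_mul, abs_of_nonneg (truncDist_nonneg d L x)]
    exact mul_le_mul_of_nonneg_right ((Ub.abs_le_norm f x).trans hfC) (truncDist_nonneg d L x)

/-- The function `g * (1 - f) + h` still has norm at most `1`, so its value is at most `N ≤ n g +
η`; cancel `n g`. -/
theorem IsOpNorm.map_le_of_norming {n : Ub X →L[ℝ] ℝ} {N : ℝ}
    (hN : IsOpNorm n N) {g f h : Ub X} {η : ℝ} (hg : ‖g‖ ≤ 1)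
    (hng : N - η ≤ n g) (hf : ∀ x, f.1 x ≤ 1) (hh : ∀ x, |h.1 x| ≤ f.1 x) :
    |n h| ≤ η + n (Ub.mul g f) := by
  have key : ∀ h : Ub X, (∀ x, |h.1 x| ≤ f.1 x) → n h ≤ η + n (Ub.mul g f) := fun h hh => by
    have h1 := hN.abs_le (h := g - Ub.mul g f + h) zero_le_one fun x => by
      have e : (g - Ub.mul g f + h).1 x = g.1 x * (1 - f.1 x) + h.1 x := by
        rw [Ub.add_apply, Ub.sub_apply, Ub.mul_apply]; ring
      rw [e]
      refine (abs_add_le _ _).trans ?_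
      have h3 : |g.1 x * (1 - f.1 x)| ≤ 1 - f.1 x := by
        rw [abs_mul, abs_of_nonneg (sub_nonneg.2 (hf x))]
        exact mul_le_of_le_one_left (sub_nonneg.2 (hf x)) ((Ub.abs_le_norm g x).trans hg)
      linarith [hh x]
    have h2 := (le_abs_self _).trans h1
    rw [map_add, Ub.map_sub] at h2
    linarith
  refine abs_le'.2 ⟨key h hh, ?_⟩
  have h1 := key ((-1 : ℝ) • h) fun x => by
    rw [Ub.smul_apply, neg_one_mul, abs_neg]
    exact hh x
  rwa [map_smul, smul_eq_mul, neg_one_mul] at h1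

/-- All truncated distances are 1-Lipschitz for `d` and bounded by `1`, uniformly in `L`. -/
theorem isUEB_mul_truncUb {d : PseudoMetric X ℝ} (hd : UCont d) (g : Ub X) :
    IsUEB (Set.range fun L : List X => Ub.mul g (truncUb hd L)) := by
  rw [isUEB_iff]
  constructor
  · intro ε hε
    have hpos : 0 < ‖g‖ + 1 := by positivity
    have hδ : 0 < ε / (‖g‖ + 1) := by positivity
    filter_upwards [uniformContinuous_real_iff.1 g.2 _ hδ, hd _ hδ] with p h1 h2
    rintro _ ⟨L, rfl⟩
    have h := abs_mul_sub_mul_le (b := truncDist d L p.1) (c := g.1 p.2) (B := 1)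
      (Ub.abs_le_norm g p.1)
      (abs_le.2 ⟨by linarith [truncDist_nonneg d L p.2], truncDist_le_one d L p.2⟩)
    refine h.trans_lt ?_
    have h3 := (truncDist_sub_le d L p.1 p.2).trans_lt h2
    rw [lt_div_iff₀ hpos] at h1 h3
    nlinarith [norm_nonneg g, abs_nonneg (g.1 p.1 - g.1 p.2),
        abs_nonneg (truncDist d L p.1 - truncDist d L p.2)]
  · refine ⟨‖g‖, ?_⟩
    rintro _ ⟨L, rfl⟩
    refine (Ub.norm_le (norm_nonneg g)).2 fun x => ?_
    rw [Ub.mul_apply, truncUb_apply, abs_mul, abs_of_nonneg (truncDist_nonneg d L x)]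
    exact (mul_le_of_le_one_right (abs_nonneg _) (truncDist_le_one d L x)).trans
      (Ub.abs_le_norm g x)

/-- Approximate `μ` by a molecular measure uniformly over all `L`, and only then take for `L` the
support of that measure. -/
theorem exists_abs_mul_truncUb_lt {d : PseudoMetric X ℝ} (hd : UCont d) {μ : Dual X}
    (hμ : μ ∈ UMeas X) (g : Ub X) {η : ℝ} (hη : 0 < η) :
    ∃ L : List X, |μ (Ub.mul g (truncUb hd L))| < η := by
  obtain ⟨ν, hν, h⟩ := Dual.mem_UMeas_iff.1 hμ _ (isUEB_mul_truncUb hd g) η hη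
  obtain ⟨L, hL⟩ := Mol.exists_list hν
  refine ⟨L, ?_⟩
  have h1 := h _ ⟨L, rfl⟩
  rwa [hL _ fun x hx => by
    rw [Ub.mul_apply, truncUb_apply, truncDist_eq_zero d hx, mul_zero], zero_sub, abs_neg] at h1

theorem UMeas.tight {d : PseudoMetric X ℝ} (hd : UCont d) {μ : Dual X} (hμ : μ ∈ UMeas X) :
    Tight μ.toCLM d := by
  intro ε hε
  obtain ⟨N, hN⟩ := exists_isOpNorm μ.toCLM
  obtain ⟨g, hg, hng⟩ := hN.exists_norming _ (half_pos hε)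
  obtain ⟨L, hL⟩ := exists_abs_mul_truncUb_lt hd hμ g (half_pos hε)
  refine ⟨L, fun h hh => ?_⟩
  refine (hN.map_le_of_norming (f := truncUb hd L) hg hng (truncDist_le_one d L) hh).trans ?_
  have := (le_abs_self _).trans_lt hL
  rw [Dual.toCLM_apply]
  linarith

/-- The unit balls of the pseudometrics in `Q` refine every entourage. -/
def IsBase (Q : PseudoMetric X ℝ → Prop) : Prop :=
  ∀ V ∈ 𝓤 X, ∃ d, Q d ∧ ∀ x y, d x y < 1 → (x, y) ∈ V

theorem IsBase.exists_of_isUEB {Q : PseudoMetric X ℝ → Prop} (hQ : IsBase Q) {H : Set (Ub X)}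
    (hH : IsUEB H) {ε : ℝ} (hε : 0 < ε) :
    ∃ d, Q d ∧ ∀ f ∈ H, ∀ x y, d x y < 1 → |f.1 x - f.1 y| ≤ ε := by
  obtain ⟨d, hd, h⟩ := hQ _ ((isUEB_iff.1 hH).1 ε hε)
  exact ⟨d, hd, fun f hf x y hxy => (h x y hxy f hf).le⟩

/-- `approx hd f L` depends on `f` linearly and only through its values on `L`. -/
theorem exists_mem_Mol_eq_map_approx {d : PseudoMetric X ℝ} (hd : UCont d) (n : Ub X →L[ℝ] ℝ)
    (L : List X) : ∃ ν ∈ Mol X, ∀ f : Ub X, ν f = n (approx hd f L) := by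
  induction L with
  | nil => exact ⟨0, zero_mem _, fun f => (map_zero n).symm⟩
  | cons z L ih =>
    obtain ⟨ν, hν, h⟩ := ih
    refine ⟨(n (truncUb hd L) - n (truncUb hd (z :: L))) • pointMass z + ν,
      add_mem (Submodule.smul_mem _ _ (Submodule.subset_span ⟨z, rfl⟩)) hν, fun f => ?_⟩
    rw [map_approx_cons, ← h f, mul_comm]
    rfl

theorem exists_pos_norm_le {H : Set (Ub X)} (hH : IsUEB H) : ∃ C > 0, ∀ f ∈ H, ‖f‖ ≤ C := by
  obtain ⟨-, C, hC⟩ := hH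
  exact ⟨max C 1, by positivity, fun f hf => (hC f hf).trans (le_max_left _ _)⟩

/-- A linear form that is tight with respect to a base of uniformly continuous pseudometrics is a
uniform measure. -/
theorem mem_UMeas_of_tight {n : Ub X →L[ℝ] ℝ} (hQ : IsBase fun d => UCont d ∧ Tight n d)
    {μ : Dual X} (hμ : μ.toCLM = n) : μ ∈ UMeas X := by
  rw [Dual.mem_UMeas_iff]
  intro H hH ε hε
  obtain ⟨N, hN⟩ := exists_isOpNorm n
  have hN0 := hN.nonneg
  obtain ⟨C, hC, hHC⟩ := exists_pos_norm_le hH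
  have hpos : 0 < N + 1 := by positivity
  have hδ : 0 < ε / 3 / (N + 1) := by positivity
  obtain ⟨d, ⟨hd, ht⟩, hdH⟩ := hQ.exists_of_isUEB hH hδ
  obtain ⟨L, hL⟩ := ht (ε / 3 / C) (by positivity)
  obtain ⟨ν, hν, hνn⟩ := exists_mem_Mol_eq_map_approx hd n L
  refine ⟨ν, hν, fun f hf => ?_⟩
  have h := abs_map_sub_map_approx_le hd n hδ.le (hdH f hf)
    (fun h hh => hN.abs_le hδ.le hh) hL hC (hHC f hf)
  rw [hνn, ← μ.toCLM_apply f, hμ, abs_sub_comm]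
  refine h.trans_lt ?_
  have h1 : N * (ε / 3 / (N + 1)) ≤ ε / 3 := by
    rw [mul_div_assoc', div_le_iff₀ hpos]
    nlinarith [hN.nonneg]
  have h2 : C * (ε / 3 / C) = ε / 3 := by field_simp
  linarith

/-- A function bounded by a sum splits into functions bounded by the summands. -/
theorem Ub.exists_add_eq {h a b : Ub X} (ha : ∀ x, 0 ≤ a.1 x) (hb : ∀ x, 0 ≤ b.1 x)
    (hab : ∀ x, |h.1 x| ≤ a.1 x + b.1 x) :
    ∃ h₁ h₂ : Ub X, h = h₁ + h₂ ∧ (∀ x, |h₁.1 x| ≤ a.1 x) ∧ ∀ x, |h₂.1 x| ≤ b.1 x := by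
  have hle : ∀ x, |max (-a.1 x) (min (a.1 x) (h.1 x))| ≤ a.1 x := fun x =>
    abs_le.2 ⟨le_max_left _ _, max_le (by linarith [ha x]) (min_le_left _ _)⟩
  let h₁ : Ub X := Ub.of (fun x => max (-a.1 x) (min (a.1 x) (h.1 x)))
    (lipschitzWith_max.uniformContinuous.comp ((UniformContinuous.neg a.2).prodMk
      (lipschitzWith_min.uniformContinuous.comp (UniformContinuous.prodMk a.2 h.2)))) ‖a‖
    fun x => (hle x).trans ((le_abs_self _).trans (Ub.abs_le_norm a x))
  refine ⟨h₁, h - h₁, Ub.ext fun x => (add_sub_cancel (h₁.1 x) (h.1 x)).symm, hle, fun x => ?_⟩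
  rw [Ub.sub_apply, Ub.of_apply]
  obtain ⟨h1, h2⟩ := abs_le.1 (hab x)
  rw [abs_le]
  have := ha x
  have := hb x
  rcases le_total (a.1 x) (h.1 x) with h3 | h3
  · rw [min_eq_left h3, max_eq_right (by linarith)]
    constructor <;> linarith
  · rw [min_eq_right h3]
    rcases le_total (-a.1 x) (h.1 x) with h4 | h4
    · rw [max_eq_right h4]
      constructor <;> linarith
    · rw [max_eq_left h4]
      constructor <;> linarith

/-- A point close to both lists is `d`-close to a representative chosen for its pair of centres; at
any other point one of the last two summands is at least `1`. -/
theorem exists_list_truncDist_le {X : Type*} {d d₁ d₂ : PseudoMetric X ℝ} {c δ : ℝ} (hc : 1 ≤ c)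
    (hδ : 0 < δ) (hδ1 : δ ≤ 1) (hd : ∀ x y, d x y ≤ c * d₁ x y + d₂ x y) (L₁ L₂ : List X) :
    ∃ L : List X, ∀ x,
      truncDist d L x ≤ 4 * δ + (c / δ * truncDist d₁ L₁ x + c / δ * truncDist d₂ L₂ x) := by
  classical
  have hc0 : 0 < c := zero_lt_one.trans_le hc
  -- The centres `z₁` and `z₂` may be far from each other, so a common near point is chosen when one
  -- exists; the default `p.1` plays no role. The radius `δ / c` absorbs the factor `c`, and two
  -- triangle inequalities give `4 * δ`.
  let y : X × X → X := fun p =>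
    if h : ∃ y, d₁ y p.1 < δ / c ∧ d₂ y p.2 < δ then h.choose else p.1
  refine ⟨(L₁ ×ˢ L₂).map y, fun x => ?_⟩
  have t1 := truncDist_nonneg d₁ L₁ x
  have t2 := truncDist_nonneg d₂ L₂ x
  have hcδ : 0 < c / δ := by positivity
  have m1 := mul_nonneg hcδ.le t1
  have m2 := mul_nonneg hcδ.le t2
  by_cases h1 : truncDist d₁ L₁ x < δ / c
  · by_cases h2 : truncDist d₂ L₂ x < δ
    · obtain ⟨z₁, hz₁, h1⟩ := exists_of_truncDist_lt d₁
        ((div_le_one hc0).2 (hδ1.trans hc)) h1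
      obtain ⟨z₂, hz₂, h2⟩ := exists_of_truncDist_lt d₂ hδ1 h2
      have hex : ∃ y, d₁ y z₁ < δ / c ∧ d₂ y z₂ < δ := ⟨x, h1, h2⟩
      have hy : y (z₁, z₂) = hex.choose := dif_pos hex
      obtain ⟨e1, e2⟩ := hex.choose_spec
      rw [← hy] at e1 e2
      have hmem : y (z₁, z₂) ∈ (L₁ ×ˢ L₂).map y :=
        List.mem_map_of_mem (List.mem_product.2 ⟨hz₁, hz₂⟩)
      refine (truncDist_le d hmem x).trans ((hd _ _).trans ?_)
      have a1 := d₁.triangle x z₁ (y (z₁, z₂))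
      have a2 := d₂.triangle x z₂ (y (z₁, z₂))
      rw [d₁.symm z₁] at a1
      rw [d₂.symm z₂] at a2
      have a3 : c * d₁ x (y (z₁, z₂)) ≤ c * (δ / c + δ / c) :=
        mul_le_mul_of_nonneg_left (by linarith) hc0.le
      have a4 : c * (δ / c + δ / c) = 2 * δ := by field_simp; ring
      linarith
    · have : 1 ≤ c / δ * truncDist d₂ L₂ x := by
        rw [div_mul_eq_mul_div, one_le_div hδ]
        nlinarith
      linarith [truncDist_le_one d ((L₁ ×ˢ L₂).map y) x]
  · have : 1 ≤ c / δ * truncDist d₁ L₁ x := by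
      rw [div_mul_eq_mul_div, one_le_div hδ]
      rw [not_lt, div_le_iff₀ hc0] at h1
      linarith
    linarith [truncDist_le_one d ((L₁ ×ˢ L₂).map y) x]

/-- Split `h` along the three summands of `exists_list_truncDist_le`: the operator norm handles the
constant, tightness the other two. -/
theorem Tight.of_le_mul_add {n : Ub X →L[ℝ] ℝ} {d d₁ d₂ : PseudoMetric X ℝ} {c : ℝ}
    (hc : 1 ≤ c) (hd : ∀ x y, d x y ≤ c * d₁ x y + d₂ x y) (hd₁ : UCont d₁) (hd₂ : UCont d₂)
    (h₁ : Tight n d₁) (h₂ : Tight n d₂) : Tight n d := by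
  intro ε hε
  obtain ⟨N, hN⟩ := exists_isOpNorm n
  have hN0 := hN.nonneg
  have hc0 : 0 < c := zero_lt_one.trans_le hc
  obtain ⟨δ, hδ, hδ1, hδn⟩ : ∃ δ : ℝ, 0 < δ ∧ δ ≤ 1 ∧ N * (4 * δ) ≤ ε / 2 := by
    have hpos : 0 < 8 * (N + 1) := by positivity
    refine ⟨min 1 (ε / (8 * (N + 1))), by positivity, min_le_left _ _, ?_⟩
    have h := min_le_right 1 (ε / (8 * (N + 1)))
    rw [le_div_iff₀ hpos] at h
    have h0 : 0 < min 1 (ε / (8 * (N + 1))) := by positivity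
    nlinarith [hN.nonneg]
  have hK : 0 < c / δ := by positivity
  obtain ⟨L₁, hL₁⟩ := h₁ (ε / 4 / (c / δ)) (by positivity)
  obtain ⟨L₂, hL₂⟩ := h₂ (ε / 4 / (c / δ)) (by positivity)
  obtain ⟨L, hL⟩ := exists_list_truncDist_le hc hδ hδ1 hd L₁ L₂
  refine ⟨L, fun h hh => ?_⟩
  have n1 : ∀ x, 0 ≤ ((c / δ) • truncUb hd₁ L₁).1 x := fun x =>
    mul_nonneg hK.le (truncDist_nonneg d₁ L₁ x)
  have n2 : ∀ x, 0 ≤ ((c / δ) • truncUb hd₂ L₂).1 x := fun x =>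
    mul_nonneg hK.le (truncDist_nonneg d₂ L₂ x)
  obtain ⟨k, k', rfl, hk, hk'⟩ := Ub.exists_add_eq (h := h)
    (a := Ub.of (fun _ => 4 * δ) uniformContinuous_const |4 * δ| fun _ => le_rfl)
    (b := (c / δ) • truncUb hd₁ L₁ + (c / δ) • truncUb hd₂ L₂)
    (fun x => by rw [Ub.of_apply]; positivity) (fun x => add_nonneg (n1 x) (n2 x))
    fun x => (hh x).trans (hL x)
  obtain ⟨k₁, k₂, rfl, hk₁, hk₂⟩ := Ub.exists_add_eq n1 n2 hk'
  have b0 := hN.abs_le (C := 4 * δ) (by positivity) hk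
  have b1 := abs_map_le_of_abs_le_mul n hL₁ hK hk₁
  have b2 := abs_map_le_of_abs_le_mul n hL₂ hK hk₂
  rw [map_add, map_add]
  refine (abs_add_le _ _).trans ((add_le_add le_rfl (abs_add_le _ _)).trans ?_)
  have e : c / δ * (ε / 4 / (c / δ)) = ε / 4 := mul_div_cancel₀ _ hK.ne'
  linarith

end Tightness

/-! ### Injectivity and embedding of positive cones when sections factor -/

section Sections

variable {X Y : Type*} [UniformSpace X] [UniformSpace Y]

/-- The functions `x ↦ d x z` factor through `φ` and a uniformly continuous function. -/
def HasSections (φ : X → Y) (d : PseudoMetric X ℝ) : Prop :=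
  ∀ z, ∃ g : Y → ℝ, UniformContinuous g ∧ ∀ x, d x z = g (φ x)

theorem HasSections.exists_comp_eq {φ : X → Y} (hφ : UniformContinuous φ) {d : PseudoMetric X ℝ}
    (hs : HasSections φ d) (hd : UCont d) (L : List X) :
    ∃ r : Ub Y, Ub.comp φ hφ r = truncUb hd L := by
  suffices ∃ r : Ub Y, (∀ y, 0 ≤ r.1 y ∧ r.1 y ≤ 1) ∧ ∀ x, r.1 (φ x) = truncDist d L x from
    this.imp fun r hr => Ub.ext hr.2
  induction L with
  | nil => exact ⟨Ub.of (fun _ => 1) uniformContinuous_const 1 (by simp), by simp, fun x => rfl⟩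
  | cons z L ih =>
    obtain ⟨r, hr, hrd⟩ := ih
    obtain ⟨g, hg, hgd⟩ := hs z
    have h0 : ∀ y, 0 ≤ min (max (g y) 0) (r.1 y) := fun y => le_min (le_max_right _ _) (hr y).1
    have h1 : ∀ y, min (max (g y) 0) (r.1 y) ≤ 1 := fun y => (min_le_right _ _).trans (hr y).2
    -- Off the range of `φ` the function `g` may be negative; the clamp at `0` keeps the bounds
    -- needed for the induction.
    refine ⟨Ub.of (fun y => min (max (g y) 0) (r.1 y))
      (lipschitzWith_min.uniformContinuous.comp
        ((lipschitzWith_max.uniformContinuous.comp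
          (hg.prodMk uniformContinuous_const)).prodMk r.2)) 1
      fun y => (abs_of_nonneg (h0 y)).trans_le (h1 y), fun y => ⟨h0 y, h1 y⟩, fun x => ?_⟩
    rw [Ub.of_apply, hrd, ← hgd, max_eq_left (d.nonneg x z)]
    rfl

theorem UMeas.map_injective {φ : X → Y} (hφ : UniformContinuous φ)
    (hQ : IsBase fun d => UCont d ∧ HasSections φ d) : Function.Injective (UMeas.map φ hφ) := by
  intro μ ν hμν
  refine Subtype.ext (UniformConvergenceCLM.ext _ _ fun f => ?_)
  have hτ : μ.1 - ν.1 ∈ UMeas X := sub_mem μ.2 ν.2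
  set n := Dual.toCLM (μ.1 - ν.1) with hn
  have hnf : ∀ f, n f = μ.1 f - ν.1 f := fun f => rfl
  rw [← sub_eq_zero, ← hnf, ← abs_nonpos_iff]
  obtain ⟨N, hN⟩ := exists_isOpNorm n
  refine le_of_forall_pos_le_add fun ε hε => ?_
  have hN0 := hN.nonneg
  have hpos : 0 < N + 1 := by positivity
  obtain ⟨d, ⟨hd, hs⟩, hdf⟩ := hQ.exists_of_isUEB (isUEB_singleton f)
    (show 0 < ε / 2 / (N + 1) by positivity)
  obtain ⟨C, hC, hfC⟩ := exists_pos_norm_le (isUEB_singleton f)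
  obtain ⟨L, hL⟩ := UMeas.tight hd hτ (ε / 2 / C) (by positivity)
  -- Truncated distances are pulled back from `Y`, where the two images agree.
  have h0 : ∀ M, n (truncUb hd M) = 0 := fun M => by
    obtain ⟨r, hr⟩ := hs.exists_comp_eq hφ hd M
    rw [hnf, ← hr, sub_eq_zero]
    exact congrArg (fun τ : UMeas Y => τ.1 r) hμν
  have h1 : ∀ M, n (approx hd f M) = 0 := fun M => by
    induction M with
    | nil => exact map_zero n
    | cons z M ih => rw [map_approx_cons, ih, h0, h0]; ring
  have h := abs_map_sub_map_approx_le hd n (by positivity) (hdf f rfl)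
    (fun h hh => hN.abs_le (by positivity) hh) hL hC (hfC f rfl)
  rw [h1, sub_zero] at h
  have h2 : N * (ε / 2 / (N + 1)) ≤ ε / 2 := by
    rw [mul_div_assoc', div_le_iff₀ hpos]
    nlinarith
  have h3 : C * (ε / 2 / C) = ε / 2 := by field_simp
  linarith

/-- For fixed `L` only finitely many limits are involved, and `f` enters through coefficients
bounded by `C`; hence the uniformity in `f`. -/
theorem eventually_abs_map_approx_sub_le {ι : Type*} {l : Filter ι} {n : ι → Ub X →L[ℝ] ℝ}
    {m : Ub X →L[ℝ] ℝ} {d : PseudoMetric X ℝ} (hd : UCont d)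
    (h : ∀ L, Tendsto (fun i => n i (truncUb hd L)) l (𝓝 (m (truncUb hd L)))) {C : ℝ} (hC : 0 < C)
    (L : List X) : ∀ ε > 0, ∀ᶠ i in l, ∀ f : Ub X, ‖f‖ ≤ C →
      |n i (approx hd f L) - m (approx hd f L)| ≤ ε := by
  induction L with
  | nil =>
    intro ε hε
    refine Eventually.of_forall fun i f _ => ?_
    rw [approx, map_zero, map_zero, sub_zero, abs_zero]
    exact hε.le
  | cons z L ih =>
    intro ε hε
    have h1 := Metric.tendsto_nhds.1 ((h L).sub (h (z :: L))) (ε / 2 / C) (by positivity)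
    filter_upwards [ih (ε / 2) (half_pos hε), h1] with i hi1 hi2 f hf
    rw [map_approx_cons, map_approx_cons, add_sub_add_comm, ← mul_sub]
    refine (abs_add_le _ _).trans ?_
    rw [Real.dist_eq] at hi2
    have h2 : |f.1 z * (n i (truncUb hd L) - n i (truncUb hd (z :: L)) -
        (m (truncUb hd L) - m (truncUb hd (z :: L))))| ≤ C * (ε / 2 / C) := by
      rw [abs_mul]
      exact mul_le_mul ((Ub.abs_le_norm f z).trans hf) hi2.le (abs_nonneg _) hC.le
    have h3 : C * (ε / 2 / C) = ε / 2 := by field_simp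
    linarith [hi1 f hf]

theorem abs_map_le_map_of_nonneg {n : Ub X →L[ℝ] ℝ} (hn : ∀ f : Ub X, (∀ x, 0 ≤ f.1 x) → 0 ≤ n f)
    {h t : Ub X} (hh : ∀ x, |h.1 x| ≤ t.1 x) : |n h| ≤ n t := by
  have h1 := hn (t - h) fun x => sub_nonneg.2 ((le_abs_self _).trans (hh x))
  have h2 := hn (t + h) fun x => by
    have := neg_le_of_abs_le (hh x)
    rw [Ub.add_apply]
    linarith
  rw [Ub.map_sub] at h1
  rw [map_add] at h2
  rw [abs_le]
  constructor <;> linarith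

/-- On the positive cone, the ueb topology is determined by the values on the truncated distance
functions of a base of pseudometrics. -/
theorem tendsto_of_tendsto_truncUb {Q : PseudoMetric X ℝ → Prop} (hQ : IsBase Q)
    (hQu : ∀ d, Q d → UCont d) {ι : Type*} {l : Filter ι} {ν : ι → Dual X} {μ : Dual X}
    (hμ : μ ∈ UMeas X) (hν0 : ∀ i, ∀ f : Ub X, (∀ x, 0 ≤ f.1 x) → 0 ≤ ν i f)
    (hμ0 : ∀ f : Ub X, (∀ x, 0 ≤ f.1 x) → 0 ≤ μ f)
    (h : ∀ d (hd : Q d) L, Tendsto (fun i => ν i (truncUb (hQu d hd) L)) l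
      (𝓝 (μ (truncUb (hQu d hd) L)))) : Tendsto ν l (𝓝 μ) := by
  refine (Dual.hasBasis_nhds μ).tendsto_right_iff.2 ?_
  rintro ⟨H, ε⟩ ⟨hH, hε : 0 < ε⟩
  obtain ⟨C, hC, hHC⟩ := exists_pos_norm_le hH
  set M := μ (Ub.of (fun _ => 1) uniformContinuous_const 1 (by simp)) with hM
  have hM0 : 0 ≤ M := hμ0 _ fun _ => zero_le_one
  have hpos : 0 < M + 1 := by positivity
  obtain ⟨δ, hδ, hδM⟩ : ∃ δ > 0, δ * (M + 1) = ε / 8 :=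
    ⟨ε / 8 / (M + 1), by positivity, div_mul_cancel₀ _ hpos.ne'⟩
  obtain ⟨d, hd, hdH⟩ := hQ.exists_of_isUEB hH hδ
  obtain ⟨η, hη, hηC⟩ : ∃ η > 0, C * η = ε / 16 := ⟨ε / 16 / C, by positivity, by field_simp⟩
  obtain ⟨L, hL⟩ := UMeas.tight (hQu d hd) hμ η hη
  have hLμ : μ (truncUb (hQu d hd) L) ≤ η := (le_abs_self _).trans <|
    hL (truncUb (hQu d hd) L) fun x => (abs_of_nonneg (truncDist_nonneg d L x)).le
  -- The truncated distance to the empty list is the constant `1`, so convergence of total masses is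
  -- part of the hypothesis.
  have hone : ∀ (τ : Dual X), (∀ f : Ub X, (∀ x, 0 ≤ f.1 x) → 0 ≤ τ f) → ∀ h : Ub X,
      (∀ x, |h.1 x| ≤ δ) → |τ.toCLM h| ≤ δ * τ.toCLM (truncUb (hQu d hd) []) := by
    intro τ hτ h hh
    rw [← smul_eq_mul, ← map_smul]
    refine abs_map_le_map_of_nonneg (n := τ.toCLM) hτ fun x => (hh x).trans_eq ?_
    exact (mul_one δ).symm
  have hlt : ∀ K, ∀ c, μ (truncUb (hQu d hd) K) < c →
      ∀ᶠ i in l, ν i (truncUb (hQu d hd) K) < c := fun K c hc => (h d hd K).eventually_lt_const hc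
  filter_upwards [hlt [] (M + 1) (lt_add_one M), hlt L (2 * η) (by linarith),
    eventually_abs_map_approx_sub_le (n := fun i => (ν i).toCLM) (m := μ.toCLM) (hQu d hd)
      (h d hd) hC L (ε / 8) (by positivity)] with i h1 h2 h3 f hf
  have e1 := abs_map_sub_map_approx_le (hQu d hd) (ν i).toCLM hδ.le (hdH f hf)
    (hone (ν i) (hν0 i))
    (fun h hh => abs_map_le_map_of_nonneg (n := (ν i).toCLM) (t := truncUb (hQu d hd) L)
      (hν0 i) hh) hC (hHC f hf)
  have e2 := abs_map_sub_map_approx_le (hQu d hd) μ.toCLM hδ.le (hdH f hf)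
    (hone μ hμ0) hL hC (hHC f hf)
  have e3 := h3 f (hHC f hf)
  have e4 : δ * (ν i).toCLM (truncUb (hQu d hd) []) ≤ δ * (M + 1) :=
    mul_le_mul_of_nonneg_left h1.le hδ.le
  have e5 : δ * μ.toCLM (truncUb (hQu d hd) []) ≤ δ * (M + 1) :=
    mul_le_mul_of_nonneg_left (lt_add_one M).le hδ.le
  have e6 : C * (ν i).toCLM (truncUb (hQu d hd) L) ≤ C * (2 * η) :=
    mul_le_mul_of_nonneg_left h2.le hC.le
  have hl : ∀ (a b c e A B E : ℝ), |a - b| ≤ A → |b - c| ≤ B → |e - c| ≤ E →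
      |a - e| ≤ A + B + E := fun a b c e A B E ha hb he => by
    rw [abs_le] at *
    constructor <;> linarith
  refine (hl _ _ _ _ _ _ _ e1 e3 e2).trans_lt ?_
  linarith

theorem UMeas.isEmbedding_mapPos {φ : X → Y} (hφ : UniformContinuous φ)
    (hQ : IsBase fun d => UCont d ∧ HasSections φ d) :
    Topology.IsEmbedding (UMeas.mapPos φ hφ) := by
  refine ⟨isInducing_iff_nhds.2 fun μ => le_antisymm ?_ ?_, fun μ ν h =>
    Subtype.ext (UMeas.map_injective hφ hQ (congrArg Subtype.val h))⟩
  · exact ((UMeas.map φ hφ).continuous.restrict (UMeas.map_mem_pos φ hφ)).continuousAt.le_comap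
  · refine tendsto_id'.1 (tendsto_subtype_rng.2 (tendsto_subtype_rng.2 ?_))
    refine tendsto_of_tendsto_truncUb hQ (fun d hd => hd.1) μ.1.2 (fun ν => ν.2) μ.2
      fun d hd L => ?_
    obtain ⟨r, hr⟩ := hd.2.exists_comp_eq hφ hd.1 L
    rw [← hr]
    have hc : Continuous fun τ : UMeasPos Y => τ.1.1 r :=
      (Dual.continuous_eval r).comp (continuous_subtype_val.comp continuous_subtype_val)
    exact hc.continuousAt.tendsto.comp tendsto_comap

end Sections

/-! ### Norm preserving extension and its tightness -/

section Extension

theorem exists_extension {E F : Type*} [NormedAddCommGroup E] [NormedSpace ℝ E]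
    [NormedAddCommGroup F] [NormedSpace ℝ F] (j : F →L[ℝ] E) (hj : ∀ f, ‖j f‖ = ‖f‖)
    (m : F →L[ℝ] ℝ) {N : ℝ} (hN : 0 ≤ N) (hm : ∀ f, |m f| ≤ N * ‖f‖) :
    ∃ n : E →L[ℝ] ℝ, (∀ f, n (j f) = m f) ∧ ∀ f, |n f| ≤ N * ‖f‖ := by
  let j' : F →ₗᵢ[ℝ] E := ⟨j.toLinearMap, hj⟩
  obtain ⟨n, hn, hnorm⟩ := exists_extension_norm_eq (LinearMap.range j'.toLinearMap)
    (m.comp (j'.equivRange.symm : _ →L[ℝ] F))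
  refine ⟨n, fun f => ?_, fun f => ?_⟩
  · have h := hn (j'.equivRange f)
    rw [ContinuousLinearMap.comp_apply] at h
    refine h.trans (congrArg m ?_)
    exact j'.equivRange.symm_apply_apply f
  · refine (n.le_opNorm f).trans (mul_le_mul_of_nonneg_right ?_ (norm_nonneg f))
    rw [hnorm]
    refine ContinuousLinearMap.opNorm_le_bound _ hN fun x => (hm _).trans_eq ?_
    congr 1
    exact j'.equivRange.symm.norm_map x

variable {X Y : Type*} [UniformSpace X] [UniformSpace Y]

theorem Ub.norm_comp {φ : X → Y} (hφ : UniformContinuous φ) (hs : Function.Surjective φ)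
    (f : Ub Y) : ‖Ub.comp φ hφ f‖ = ‖f‖ := by
  refine le_antisymm ((Ub.norm_le ((norm_nonneg f.1))).2 fun x => Ub.abs_le_norm f (φ x))
    ((Ub.norm_le (norm_nonneg (Ub.comp φ hφ f).1)).2 fun y => ?_)
  obtain ⟨x, rfl⟩ := hs y
  exact Ub.abs_le_norm (Ub.comp φ hφ f) x

theorem exists_extension_Ub {φ : X → Y} (hφ : UniformContinuous φ) (hs : Function.Surjective φ)
    (m : Ub Y →L[ℝ] ℝ) {N : ℝ} (hN : IsOpNorm m N) :
    ∃ n : Ub X →L[ℝ] ℝ, IsOpNorm n N ∧ ∀ r, n (Ub.comp φ hφ r) = m r := by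
  obtain ⟨n, hn, hle⟩ := exists_extension (E := Ub X) (F := Ub Y) (Ub.comp φ hφ)
    (Ub.norm_comp hφ hs) m hN.nonneg hN.le
  refine ⟨n, ⟨hN.nonneg, hle, fun η hη => ?_⟩, hn⟩
  obtain ⟨g, hg, hng⟩ := hN.exists_norming η hη
  exact ⟨Ub.comp φ hφ g, (Ub.norm_comp hφ hs g).trans_le hg, (hn g).symm ▸ hng⟩

theorem truncDist_map {X X₀ : Type*} {ψ : X → X₀} {d : PseudoMetric X ℝ} {d₀ : PseudoMetric X₀ ℝ}
    (h : ∀ x y, d x y = d₀ (ψ x) (ψ y)) (L : List X) (x : X) :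
    truncDist d₀ (L.map ψ) (ψ x) = truncDist d L x := by
  induction L with
  | nil => rfl
  | cons z L ih => simp only [List.map_cons, truncDist, ih, h]

/-- A norm preserving extension of a uniform measure on an intermediate space `X₀` is tight with
respect to the pseudometrics of `X₀`. -/
theorem tight_of_extension {X₀ : Type*} [UniformSpace X₀] {ψ : X → X₀} {φ₀ : X₀ → Y}
    (hψ : Function.Surjective ψ) (hφ₀ : UniformContinuous φ₀)
    (hφ : UniformContinuous (φ₀ ∘ ψ)) {n : Ub X →L[ℝ] ℝ} {m : Ub Y →L[ℝ] ℝ} {N : ℝ}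
    (hm : IsOpNorm m N) (hn : IsOpNorm n N) (hnm : ∀ r, n (Ub.comp (φ₀ ∘ ψ) hφ r) = m r)
    {μ : Dual X₀} (hμ : μ ∈ UMeas X₀) (hμm : ∀ r, μ (Ub.comp φ₀ hφ₀ r) = m r)
    {d : PseudoMetric X ℝ} {d₀ : PseudoMetric X₀ ℝ} (hd : UCont d) (hd₀ : UCont d₀)
    (hs : HasSections φ₀ d₀) (hdd : ∀ x y, d x y = d₀ (ψ x) (ψ y)) : Tight n d := by
  intro ε hε
  -- The norming function is taken on `Y`; its pullback is norming for `n` because the norms agree.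
  -- Its product with a truncated distance then also comes from `Y`, where `n` and `μ` can be
  -- compared.
  obtain ⟨g, hg, hng⟩ := hm.exists_norming _ (half_pos hε)
  obtain ⟨L₀, hL₀⟩ := exists_abs_mul_truncUb_lt hd₀ hμ (Ub.comp φ₀ hφ₀ g) (half_pos hε)
  obtain ⟨L, rfl⟩ := hψ.list_map L₀
  obtain ⟨r, hr⟩ := hs.exists_comp_eq hφ₀ hd₀ (L.map ψ)
  refine ⟨L, fun h hh => ?_⟩
  have hg' : ‖Ub.comp (φ₀ ∘ ψ) hφ g‖ ≤ 1 := (Ub.norm_le zero_le_one).2 fun x =>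
    (Ub.abs_le_norm g _).trans hg
  refine (hn.map_le_of_norming (f := truncUb hd L) hg' ((hnm g).symm ▸ hng)
    (truncDist_le_one d L) hh).trans ?_
  have e1 : Ub.mul (Ub.comp (φ₀ ∘ ψ) hφ g) (truncUb hd L) =
      Ub.comp (φ₀ ∘ ψ) hφ (Ub.mul g r) := Ub.ext fun x => by
    have h1 : r.1 (φ₀ (ψ x)) = truncDist d₀ (L.map ψ) (ψ x) :=
      congrArg (fun f : Ub X₀ => f.1 (ψ x)) hr
    rw [Ub.mul_apply, Ub.comp_apply, Ub.comp_apply, Ub.mul_apply, Function.comp_apply, h1,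
      truncDist_map hdd, truncUb_apply]
  have e2 : Ub.mul (Ub.comp φ₀ hφ₀ g) (truncUb hd₀ (L.map ψ)) =
      Ub.comp φ₀ hφ₀ (Ub.mul g r) := by
    rw [← hr]
    rfl
  rw [e2, hμm] at hL₀
  rw [e1, hnm]
  linarith [le_abs_self (m (Ub.mul g r))]

end Extension

/-! ### Uniform structures induced by pseudometrics -/

section Induced

variable {S : Type*}

theorem uCont_of_mem {P : Set (PseudoMetric S ℝ)} {ρ : PseudoMetric S ℝ} (hρ : ρ ∈ P) :
    @UCont S (inducedUniformity P) ρ := by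
  intro ε hε
  have h : inducedUniformity P ≤ pseudometricUniformity ρ := iInf₂_le ρ hρ
  refine h ?_
  exact (UniformSpace.hasBasis_ofFun (exists_gt (0 : ℝ)) ρ ρ.refl ρ.symm ρ.triangle
    UniformSpace.ofDist_aux).mem_of_mem hε

/-- Finite weighted sums of members of `P` have unit balls that refine every entourage, so it
suffices that `Q` is stable under adding one weighted member. -/
theorem isBase_inducedUniformity {P : Set (PseudoMetric S ℝ)} {Q : PseudoMetric S ℝ → Prop}
    (hbot : Q ⊥) (hadd : ∀ ρ ∈ P, ∀ d, Q d → ∀ c : ℝ, 1 ≤ c → ∀ d' : PseudoMetric S ℝ,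
      (∀ x y, d' x y = c * ρ x y + d x y) → Q d') :
    @IsBase S (inducedUniformity P) Q := by
  intro V hV
  rw [inducedUniformity, iInf_subtype', iInf_uniformity] at hV
  refine iInf_sets_induct hV ⟨⊥, hbot, fun _ _ _ => trivial⟩ ?_
  rintro ⟨ρ, hρ⟩ s t hs ⟨d, hd, hdt⟩
  obtain ⟨ε, hε, hεs⟩ := (UniformSpace.hasBasis_ofFun (exists_gt (0 : ℝ)) ρ ρ.refl ρ.symm
    ρ.triangle UniformSpace.ofDist_aux).mem_iff.1 hs
  -- The factor `ε⁻¹` shrinks the unit ball of the sum into the `ε`-ball of `ρ`; the maximum with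
  -- `1` meets the condition `1 ≤ c`.
  have hc : 0 ≤ max 1 ε⁻¹ := by positivity
  let d' : PseudoMetric S ℝ :=
    { toFun := fun x y => max 1 ε⁻¹ * ρ x y + d x y
      refl' := fun x => by simp
      symm' := fun x y => by rw [ρ.symm, d.symm]
      triangle' := fun x y z => by
        have h1 := mul_le_mul_of_nonneg_left (ρ.triangle x y z) hc
        have h2 := d.triangle x y z
        linarith }
  have hd' : ∀ x y, d' x y = max 1 ε⁻¹ * ρ x y + d x y := fun _ _ => rfl
  refine ⟨d', hadd ρ hρ d hd _ (le_max_left _ _) d' hd', fun x y hxy => ⟨hεs ?_, hdt x y ?_⟩⟩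
  · rw [hd'] at hxy
    have h1 : ε⁻¹ * ρ x y ≤ max 1 ε⁻¹ * ρ x y :=
      mul_le_mul_of_nonneg_right (le_max_right _ _) (ρ.nonneg x y)
    have h2 : ε⁻¹ * ρ x y < 1 := by linarith [d.nonneg x y]
    rwa [inv_mul_lt_iff₀ hε, mul_one] at h2
  · rw [hd'] at hxy
    linarith [mul_nonneg hc (ρ.nonneg x y)]

theorem UCont.mul_add {X : Type*} [UniformSpace X] {ρ d d' : PseudoMetric X ℝ} (hρ : UCont ρ)
    (hd : UCont d) {c : ℝ} (hc : 1 ≤ c) (h : ∀ x y, d' x y = c * ρ x y + d x y) : UCont d' := by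
  intro ε hε
  have hc0 : 0 < c := zero_lt_one.trans_le hc
  filter_upwards [hρ (ε / 2 / c) (by positivity), hd (ε / 2) (half_pos hε)] with p h1 h2
  rw [lt_div_iff₀ hc0] at h1
  rw [h]
  linarith

theorem uCont_bot {X : Type*} [UniformSpace X] : UCont (⊥ : PseudoMetric X ℝ) :=
  fun _ hε => Eventually.of_forall fun _ => hε

theorem HasSections.mul_add {X Y : Type*} [UniformSpace Y] {φ : X → Y} [UniformSpace X]
    {ρ d d' : PseudoMetric X ℝ} (hρ : HasSections φ ρ) (hd : HasSections φ d) {c : ℝ}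
    (h : ∀ x y, d' x y = c * ρ x y + d x y) : HasSections φ d' := fun z => by
  obtain ⟨g, hg, e⟩ := hρ z
  obtain ⟨k, hk, e'⟩ := hd z
  exact ⟨fun y => c * g y + k y, (hg.const_mul' c).add hk, fun x => by rw [h, e, e']⟩

theorem hasSections_bot {X Y : Type*} [UniformSpace Y] {φ : X → Y} [UniformSpace X] :
    HasSections φ (⊥ : PseudoMetric X ℝ) :=
  fun _ => ⟨fun _ => 0, uniformContinuous_const, fun _ => rfl⟩

theorem isInjectivePosEmbedding_of_sections {P : Set (PseudoMetric S ℝ)} {u v : UniformSpace S}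
    (hu : u = inducedUniformity P) (h : u ≤ v)
    (hs : ∀ ρ ∈ P, ∀ z : S, UniformContinuous (fun x : Space v => ρ x z)) :
    IsInjectivePosEmbedding h := by
  subst hu
  have hQ : IsBase (X := Space (inducedUniformity P)) fun d =>
      UCont (X := Space (inducedUniformity P)) d ∧
        HasSections (X := Space (inducedUniformity P)) (Y := Space v) (fun x => x) d :=
    isBase_inducedUniformity (P := P) ⟨uCont_bot, hasSections_bot⟩ fun ρ hρ d hd c hc d' hd' =>
      ⟨UCont.mul_add (X := Space (inducedUniformity P)) (uCont_of_mem hρ) hd.1 hc hd',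
        HasSections.mul_add (X := Space (inducedUniformity P)) (Y := Space v)
          (fun z => ⟨_, hs ρ hρ z, fun _ => rfl⟩) hd.2 hd'⟩
  exact ⟨UMeas.map_injective (X := Space (inducedUniformity P)) (Y := Space v) (φ := fun x => x) h hQ,
    UMeas.isEmbedding_mapPos (X := Space (inducedUniformity P)) (Y := Space v) (φ := fun x => x) h hQ⟩

theorem uCont_mono {u v : UniformSpace S} (h : u ≤ v) {d : PseudoMetric S ℝ}
    (hd : @UCont S v d) : @UCont S u d := fun ε hε => h (hd ε hε)

theorem inducedUniformity_union (P₀ P₁ : Set (PseudoMetric S ℝ)) :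
    inducedUniformity (P₀ ∪ P₁) = inducedUniformity P₀ ⊓ inducedUniformity P₁ := iInf_union

theorem uniformContinuous_sup_dom {u v : UniformSpace S} {f : S → ℝ}
    (hu : UniformContinuous (α := Space u) f) (hv : UniformContinuous (α := Space v) f) :
    UniformContinuous (α := Space (u ⊔ v)) f := by
  have h : u ⊔ v ≤ UniformSpace.comap f inferInstance :=
    sup_le (uniformContinuous_iff_le_comap.1 hu) (uniformContinuous_iff_le_comap.1 hv)
  exact uniformContinuous_iff_le_comap.2 h

theorem tight_bot {X : Type*} [UniformSpace X] (n : Ub X →L[ℝ] ℝ) : Tight n ⊥ := by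
  intro ε hε
  obtain ⟨L, hL⟩ : ∃ L : List X, ∀ x, truncDist ⊥ L x ≤ 0 := by
    rcases isEmpty_or_nonempty X with h | ⟨⟨z⟩⟩
    · exact ⟨[], fun x => h.elim x⟩
    · exact ⟨[z], fun x => min_le_left _ _⟩
  refine ⟨L, fun h hh => ?_⟩
  have h0 : h = 0 := Ub.ext fun x => abs_nonpos_iff.1 ((hh x).trans (hL x))
  rw [h0, map_zero, abs_zero]
  exact hε.le

/-- Two uniform measures that agree on the coarser space come from a uniform measure on the common
refinement. -/
theorem exists_idMap_eq {P₀ P₁ : Set (PseudoMetric S ℝ)} {u₀ u₁ v : UniformSpace S}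
    (hu₀ : u₀ = inducedUniformity P₀) (hu₁ : u₁ = inducedUniformity P₁)
    (hv₀ : u₀ ≤ v) (hv₁ : u₁ ≤ v)
    (hs₀ : ∀ ρ ∈ P₀, ∀ z : S, UniformContinuous (fun x : Space v => ρ x z))
    (hs₁ : ∀ ρ ∈ P₁, ∀ z : S, UniformContinuous (fun x : Space v => ρ x z))
    (μ₀ : UMeas (Space u₀)) (μ₁ : UMeas (Space u₁)) (h : idMap hv₀ μ₀ = idMap hv₁ μ₁)
    (hv : u₀ ⊓ u₁ ≤ v) : ∃ μ : UMeas (Space (u₀ ⊓ u₁)), idMap hv μ = idMap hv₀ μ₀ := by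
  obtain ⟨N, hm⟩ := exists_isOpNorm (X := Space v) (idMap hv₀ μ₀).1.toCLM
  obtain ⟨n, hn, hnm⟩ := exists_extension_Ub (X := Space (u₀ ⊓ u₁)) (Y := Space v)
    (φ := fun x => x) hv Function.surjective_id _ hm
  have hQ : IsBase (X := Space (u₀ ⊓ u₁)) fun d => UCont d ∧ Tight n d := by
    have e : u₀ ⊓ u₁ = inducedUniformity (P₀ ∪ P₁) := by
      rw [inducedUniformity_union, hu₀, hu₁]
    have hQ : ∀ ρ ∈ P₀ ∪ P₁, UCont (X := Space (u₀ ⊓ u₁)) ρ ∧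
        Tight (X := Space (u₀ ⊓ u₁)) n ρ := by
      rintro ρ (hρ | hρ)
      · have hc : UCont (X := Space u₀) ρ := by
          subst hu₀
          exact uCont_of_mem hρ
        have hc' : UCont (X := Space (u₀ ⊓ u₁)) ρ := uCont_mono inf_le_left hc
        exact ⟨hc', tight_of_extension (X := Space (u₀ ⊓ u₁)) (X₀ := Space u₀) (Y := Space v)
          (ψ := fun x => x) (φ₀ := fun x => x) Function.surjective_id hv₀ hv hm hn hnm μ₀.2
          (fun _ => rfl) hc' hc (fun z => ⟨_, hs₀ ρ hρ z, fun _ => rfl⟩) fun _ _ => rfl⟩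
      · have hc : UCont (X := Space u₁) ρ := by
          subst hu₁
          exact uCont_of_mem hρ
        have hc' : UCont (X := Space (u₀ ⊓ u₁)) ρ := uCont_mono inf_le_right hc
        exact ⟨hc', tight_of_extension (X := Space (u₀ ⊓ u₁)) (X₀ := Space u₁) (Y := Space v)
          (ψ := fun x => x) (φ₀ := fun x => x) Function.surjective_id hv₁ hv hm hn hnm μ₁.2
          (fun r => congrArg (fun τ : UMeas (Space v) => τ.1 r) h.symm) hc' hc
          (fun z => ⟨_, hs₁ ρ hρ z, fun _ => rfl⟩) fun _ _ => rfl⟩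
    -- Tightness is known for single members of `P₀` and `P₁`; stability under weighted sums extends
    -- it to a base of the refinement.
    have hb := isBase_inducedUniformity (P := P₀ ∪ P₁)
      (Q := fun d => UCont (X := Space (u₀ ⊓ u₁)) d ∧ Tight (X := Space (u₀ ⊓ u₁)) n d)
      ⟨uCont_bot, tight_bot n⟩ fun ρ hρ d hd c hc d' hd' =>
        ⟨UCont.mul_add (X := Space (u₀ ⊓ u₁)) (hQ ρ hρ).1 hd.1 hc hd',
          Tight.of_le_mul_add (X := Space (u₀ ⊓ u₁)) hc (fun x y => (hd' x y).le) (hQ ρ hρ).1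
            hd.1 (hQ ρ hρ).2 hd.2⟩
    rwa [← e] at hb
  refine ⟨⟨n, mem_UMeas_of_tight hQ rfl⟩, Subtype.ext (UniformConvergenceCLM.ext _ _ fun r => ?_)⟩
  exact hnm r

end Induced

end UniformMeasure

end

/-! ### The general embedding theorem -/

open UniformMeasure in
theorem mainTheorem3 {S : Type*} (P₀ P₁ : Set (PseudoMetric S ℝ))
    (hP₀ : SeparatesPoints P₀) (hP₁ : SeparatesPoints P₁)
    (u₀ u₁ : UniformSpace S)
    (hu₀ : u₀ = inducedUniformity P₀) (hu₁ : u₁ = inducedUniformity P₁)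
    (h₀ : ∀ ρ ∈ P₀, ∀ z : S, UniformContinuous (fun x : Space u₁ => ρ x z))
    (h₁ : ∀ ρ ∈ P₁, ∀ z : S, UniformContinuous (fun x : Space u₀ => ρ x z)) :
    -- In Mathlib's order `u ≤ v` means that `u` is finer than `v`, so the supremum of
    -- the two uniform structures in the usual sense is `u₀ ⊓ u₁` and their infimum is `u₀ ⊔ u₁`.
    IsInjectivePosEmbedding (inf_le_left : u₀ ⊓ u₁ ≤ u₀) ∧
    IsInjectivePosEmbedding (inf_le_right : u₀ ⊓ u₁ ≤ u₁) ∧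
    IsInjectivePosEmbedding (le_sup_left : u₀ ≤ u₀ ⊔ u₁) ∧
    IsInjectivePosEmbedding (le_sup_right : u₁ ≤ u₀ ⊔ u₁) ∧
    IsInjectivePosEmbedding (inf_le_sup : u₀ ⊓ u₁ ≤ u₀ ⊔ u₁) ∧
    Set.range (idMap (inf_le_sup : u₀ ⊓ u₁ ≤ u₀ ⊔ u₁)) =
      Set.range (idMap (le_sup_left : u₀ ≤ u₀ ⊔ u₁)) ∩
        Set.range (idMap (le_sup_right : u₁ ≤ u₀ ⊔ u₁)) := by
  have s₀ : ∀ ρ ∈ P₀, ∀ z : S, UniformContinuous (fun x : Space u₀ => ρ x z) := by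
    subst hu₀
    exact fun ρ hρ z => UCont.uniformContinuous_left (X := Space (inducedUniformity P₀)) (uCont_of_mem hρ) z
  have s₁ : ∀ ρ ∈ P₁, ∀ z : S, UniformContinuous (fun x : Space u₁ => ρ x z) := by
    subst hu₁
    exact fun ρ hρ z => UCont.uniformContinuous_left (X := Space (inducedUniformity P₁)) (uCont_of_mem hρ) z
  -- A real function uniformly continuous for both structures is so for their finest common
  -- coarsening; this is where the two-sided hypothesis enters.
  have t₀ : ∀ ρ ∈ P₀, ∀ z : S, UniformContinuous (fun x : Space (u₀ ⊔ u₁) => ρ x z) :=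
    fun ρ hρ z => uniformContinuous_sup_dom (s₀ ρ hρ z) (h₀ ρ hρ z)
  have t₁ : ∀ ρ ∈ P₁, ∀ z : S, UniformContinuous (fun x : Space (u₀ ⊔ u₁) => ρ x z) :=
    fun ρ hρ z => uniformContinuous_sup_dom (h₁ ρ hρ z) (s₁ ρ hρ z)
  have e : u₀ ⊓ u₁ = inducedUniformity (P₀ ∪ P₁) := by
    rw [inducedUniformity_union, hu₀, hu₁]
  refine ⟨isInjectivePosEmbedding_of_sections e _ ?_, isInjectivePosEmbedding_of_sections e _ ?_,
    isInjectivePosEmbedding_of_sections hu₀ _ t₀, isInjectivePosEmbedding_of_sections hu₁ _ t₁,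
    isInjectivePosEmbedding_of_sections e _ ?_, Set.Subset.antisymm ?_ ?_⟩
  · exact fun ρ hρ => hρ.elim (s₀ ρ) (h₁ ρ)
  · exact fun ρ hρ => hρ.elim (h₀ ρ) (s₁ ρ)
  · exact fun ρ hρ => hρ.elim (t₀ ρ) (t₁ ρ)
  · rintro _ ⟨μ, rfl⟩
    exact ⟨⟨idMap inf_le_left μ, rfl⟩, ⟨idMap inf_le_right μ, rfl⟩⟩
  · rintro _ ⟨⟨μ₀, rfl⟩, ⟨μ₁, hμ⟩⟩
    exact exists_idMap_eq hu₀ hu₁ le_sup_left le_sup_right t₀ t₁ μ₀ μ₁ hμ.symm _
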